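/- A hypergraph $H$ consists of a finite vertex set $V(H)$ and a set $E(H)$ of subsets of $V(H)$, its edges. It is $r$-uniform if every edge has exactly $r$ vertices, and linear if any two distinct edges share at most one vertex. Write $d_H(v)$ for the number of edges containing $v$. The signless Laplacian spectral radius of an $r$-uniform hypergraph $H$ is $$q(H):=\max\Big\{\sum_{v\in V(H)}d_H(v)\,x_v^{r}+r\sum_{e\in E(H)}\prod_{v\in e}x_v \;:\; x\in\mathbb{R}^{V(H)},\ \sum_{v\in V(H)}|x_v|^r=1\Big\}.$$ The $r$-expansion of a graph $F$ is the $r$-uniform hypergraph obtained from $F$ by enlarging each edge with $r-2$ new vertices not in $V(F)$, distinct edges being enlarged by disjoint sets of new vertices. Let $K_{k+1}[\ell]$ be the complete $(k+1)$-partite graph with $\ell$ vertices in each part. **Theorem.** Let $k\ge 2$, $\ell\ge 1$, $r\ge 2$ be integers and let $0<\varepsilon<1/(k-1)$ be real. There is an $n_0=n_0(k,\ell,r,\varepsilon)$ such that for every $n\ge n_0$, every linear $r$-uniform hypergraph $H$ on $n$ vertices with $$q(H)\ \ge\ \frac{2n}{r-1}\Big(1-\frac1k+\varepsilon\Big)$$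 contains the $r$-expansion of $K_{k+1}[\ell]$ as a (not necessarily induced) subhypergraph. -/

import Mathlib

noncomputable section

namespace Hypergraph

variable {α β : Type*}

/-- Every edge of `H` has exactly `r` vertices (used for `r ≥ 2`, so edges are finite sets). -/
def IsUniform (H : Hypergraph α) (r : ℕ) : Prop :=
  ∀ e ∈ H.edgeSet, e.ncard = r

/-- Any two distinct edges of `H` share at most one vertex. -/
def IsLinear (H : Hypergraph α) : Prop :=
  H.edgeSet.Pairwise fun e f => (e ∩ f).Subsingleton

/-- The number `d_H(v)` of edges of `H` containing the vertex `v`. -/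
def degree (H : Hypergraph α) (v : α) : ℕ :=
  {e ∈ H.edgeSet | v ∈ e}.ncard

/-- `∑_{v ∈ V(H)} d_H(v) x_v ^ r + r ∑_{e ∈ E(H)} ∏_{v ∈ e} x_v`. The sums are finite since `V(H)`
is finite in all uses; the values of `x` outside `V(H)` do not matter. -/
def signlessForm (H : Hypergraph α) (r : ℕ) (x : α → ℝ) : ℝ :=
  (∑ᶠ v ∈ H.vertexSet, (H.degree v : ℝ) * x v ^ r) +
    (r : ℝ) * ∑ᶠ e ∈ H.edgeSet, ∏ᶠ v ∈ e, x v

/-- The values of the form on the vectors with `∑_{v ∈ V(H)} |x_v| ^ r = 1`, that is, on the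
vectors of `ℝ ^ V(H)` whose `r`-norm is `1`. -/
def signlessValues (H : Hypergraph α) (r : ℕ) : Set ℝ :=
  {y | ∃ x : α → ℝ, ∑ᶠ v ∈ H.vertexSet, |x v| ^ r = 1 ∧ H.signlessForm r x = y}

/-- The signless Laplacian spectral radius `q(H)` of an `r`-uniform hypergraph `H`: the maximum of
the form over the vectors of `r`-norm `1` (`isGreatest_qIndex`: the maximum is attained). -/
def qIndex (H : Hypergraph α) (r : ℕ) : ℝ :=
  sSup (H.signlessValues r)

/-- The supremum defining `q(H)` is a maximum. -/
theorem isGreatest_qIndex (H : Hypergraph α) (hfin : H.vertexSet.Finite)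
    (hne : H.vertexSet.Nonempty) {r : ℕ} (hr : 1 ≤ r) :
    IsGreatest (H.signlessValues r) (H.qIndex r) := by
  classical
  have hE : H.edgeSet.Finite :=
    hfin.finite_subsets.subset fun e he => H.subset_vertexSet_of_mem_edgeSet' he
  have hcont : Continuous (H.signlessForm r) := by
    have h1 : H.signlessForm r = fun x : α → ℝ =>
        (∑ v ∈ hfin.toFinset, (H.degree v : ℝ) * x v ^ r) +
          (r : ℝ) * ∑ e ∈ hE.toFinset, ∏ᶠ v ∈ e, x v := by
      funext x
      rw [signlessForm, finsum_mem_eq_finite_toFinset_sum _ hfin,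
        finsum_mem_eq_finite_toFinset_sum _ hE]
    rw [h1]
    refine Continuous.add (by fun_prop) (continuous_const.mul ?_)
    refine continuous_finsetSum _ fun e he => ?_
    have hef : e.Finite :=
      hfin.subset (H.subset_vertexSet_of_mem_edgeSet' (hE.mem_toFinset.1 he))
    have h2 : (fun x : α → ℝ => ∏ᶠ v ∈ e, x v) = fun x => ∏ v ∈ hef.toFinset, x v := by
      funext x
      exact finprod_mem_eq_finite_toFinset_prod _ hef
    rw [h2]
    fun_prop
  let N : (α → ℝ) → ℝ := fun x => ∑ v ∈ hfin.toFinset, |x v| ^ r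
  have hN : ∀ x : α → ℝ, ∑ᶠ v ∈ H.vertexSet, |x v| ^ r = N x := fun x =>
    finsum_mem_eq_finite_toFinset_sum _ hfin
  let B : Set (α → ℝ) := Set.univ.pi fun _ => Set.Icc (-1 : ℝ) 1
  have hB : IsCompact B := isCompact_univ_pi fun _ => isCompact_Icc
  have hNc : Continuous N := by fun_prop
  let K : Set (α → ℝ) := B ∩ N ⁻¹' {1}
  have hK : IsCompact K := hB.inter_right (isClosed_singleton.preimage hNc)
  have heq : H.signlessValues r = H.signlessForm r '' K := by
    ext y
    constructor
    · rintro ⟨x, hx, rfl⟩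
      rw [hN] at hx
      let z : α → ℝ := fun v => if v ∈ H.vertexSet then x v else 0
      have hz : ∀ v ∈ H.vertexSet, z v = x v := fun v hv => if_pos hv
      refine ⟨z, ⟨?_, ?_⟩, ?_⟩
      · intro v _
        by_cases hv : v ∈ H.vertexSet
        · have h3 : |x v| ^ r ≤ N x :=
            Finset.single_le_sum (f := fun v => |x v| ^ r) (fun i _ => by positivity)
              (hfin.mem_toFinset.2 hv)
          have h4 : |x v| ≤ 1 := by
            by_contra hlt
            have h5 := one_lt_pow₀ (not_le.1 hlt) (by omega : r ≠ 0)
            linarith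
          rw [hz v hv]
          exact abs_le.1 h4
        · simp [z, hv]
      · change N z = 1
        rw [← hx]
        exact Finset.sum_congr rfl fun v hv => by rw [hz v (hfin.mem_toFinset.1 hv)]
      · unfold signlessForm
        congr 1
        · exact finsum_mem_congr rfl fun v hv => by rw [hz v hv]
        · congr 1
          refine finsum_mem_congr rfl fun e he => finprod_mem_congr rfl fun v hv => ?_
          exact hz v (H.subset_vertexSet_of_mem_edgeSet' he hv)
    · rintro ⟨x, ⟨_, hx⟩, rfl⟩
      exact ⟨x, (hN x).trans hx, rfl⟩
  have hvne : (H.signlessValues r).Nonempty := by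
    obtain ⟨w, hw⟩ := hne
    refine ⟨_, fun v => if v = w then 1 else 0, ?_, rfl⟩
    rw [hN]
    change ∑ v ∈ hfin.toFinset, |if v = w then (1 : ℝ) else 0| ^ r = 1
    rw [Finset.sum_eq_single w]
    · simp
    · intro b _ hb
      simp [hb, show r ≠ 0 by omega]
    · intro h
      exact absurd (hfin.mem_toFinset.2 hw) h
  have hcomp : IsCompact (H.signlessValues r) := heq ▸ hK.image hcont
  exact hcomp.isGreatest_sSup hvne

/-- `H` contains a copy of `F`: an injective map of the vertices of `F` to vertices of `H` that
sends every edge of `F` to an edge of `H` (the copy need not be induced). -/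
def ContainsCopy (H : Hypergraph α) (F : Hypergraph β) : Prop :=
  ∃ f : β → α, Set.InjOn f F.vertexSet ∧ Set.MapsTo f F.vertexSet H.vertexSet ∧
    ∀ e ∈ F.edgeSet, f '' e ∈ H.edgeSet

/-- The `r`-expansion of a graph `F` (for `r ≥ 2`): each edge `e` of `F` is enlarged by `r - 2` new
vertices `(e, i)`, `i < r - 2`, with distinct edges enlarged by distinct vertices. -/
def expansion (F : SimpleGraph β) (r : ℕ) : Hypergraph (β ⊕ (F.edgeSet × Fin (r - 2))) where
  vertexSet := Set.univ
  edgeSet := Set.range fun e : F.edgeSet =>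
    Sum.inl '' {v : β | v ∈ (e : Sym2 β)} ∪
      Sum.inr '' {p : F.edgeSet × Fin (r - 2) | p.1 = e}
  subset_vertexSet_of_mem_edgeSet' := fun _ _ => Set.subset_univ _

end Hypergraph

end

/-! In a linear hypergraph two vertices lie in at most one common edge, so the edges of `H` become
edge-disjoint cliques of its shadow graph. With `y v = |x v| ^ (r / 2)`, AM–GM on each clique bounds
`r - 1` times the form of `H` by the signless Laplacian form of the shadow
(`signlessForm_le_shadow`), whose maximum is therefore at least `2n(1 - 1/k + ε)`.

To pass from this spectral bound to degrees, write `q(S)` for the maximum of the form on `S` and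
maximise `q(S) / |S| ^ (1 - θ)` over vertex sets. Comparison with the whole set shows that `S` is a
positive proportion of it and no less dense. Comparison with `S` minus a vertex of smallest
eigenvector entry shows that this entry is nearly `|S| ^ (-1/2)`; the eigenvalue equation then makes
every degree in `S` large (`exists_subset_degree_ge`). The minimum-degree Erdős–Stone theorem yields
`K_{k+1}[L]` in the shadow for any fixed `L`.

For large `L`, `ℓ` vertices per part can be chosen greedily so that the hyperedges through their
adjacent pairs contain no third chosen vertex and meet only in chosen vertices
(`exists_pairSparse_representatives`). These hyperedges form the expansion. -/

namespace SimpleGraph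

variable {V : Type*} (G : SimpleGraph V)

/-! ### The signless Laplacian form of a graph -/

open Classical in
/-- The quadratic form of the signless Laplacian of the subgraph of `G` induced on `S`. -/
noncomputable def signlessFormOn (S : Finset V) (y : V → ℝ) : ℝ :=
  (∑ u ∈ S, ∑ v ∈ S with G.Adj u v, (y u + y v) ^ 2) / 2

open Classical in
theorem signlessFormOn_eq_erase_add {S : Finset V} {u : V} (hu : u ∈ S) (y : V → ℝ) :
    G.signlessFormOn S y = G.signlessFormOn (S.erase u) y +
      ∑ v ∈ S with G.Adj u v, (y u + y v) ^ 2 := by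
  unfold signlessFormOn
  simp only [Finset.sum_filter]
  rw [← Finset.add_sum_erase S _ hu]
  have h1 : ∀ a, ∑ v ∈ S, (if G.Adj a v then (y a + y v) ^ 2 else 0) =
      (if G.Adj a u then (y a + y u) ^ 2 else 0) +
        ∑ v ∈ S.erase u, (if G.Adj a v then (y a + y v) ^ 2 else 0) := fun a =>
    (Finset.add_sum_erase S _ hu).symm
  simp only [h1, Finset.sum_add_distrib, G.irrefl, if_false]
  have h2 : ∑ a ∈ S.erase u, (if G.Adj a u then (y a + y u) ^ 2 else 0) =
      ∑ v ∈ S.erase u, (if G.Adj u v then (y u + y v) ^ 2 else 0) :=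
    Finset.sum_congr rfl fun a _ => by simp only [G.adj_comm a u, add_comm (y a)]
  rw [h2]
  ring

theorem signlessFormOn_nonneg (S : Finset V) (y : V → ℝ) : 0 ≤ G.signlessFormOn S y :=
  div_nonneg (Finset.sum_nonneg fun _ _ => Finset.sum_nonneg fun _ _ => sq_nonneg _) zero_le_two

theorem signlessFormOn_congr {S : Finset V} {y z : V → ℝ} (h : ∀ v ∈ S, y v = z v) :
    G.signlessFormOn S y = G.signlessFormOn S z := by
  classical
  unfold signlessFormOn
  congr 1
  refine Finset.sum_congr rfl fun u hu => Finset.sum_congr rfl fun v hv => ?_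
  rw [h u hu, h v (Finset.mem_filter.1 hv).1]

theorem signlessFormOn_smul (S : Finset V) (c : ℝ) (y : V → ℝ) :
    G.signlessFormOn S (fun v => c * y v) = c ^ 2 * G.signlessFormOn S y := by
  unfold signlessFormOn
  rw [mul_div_assoc', Finset.mul_sum]
  congr 1
  refine Finset.sum_congr rfl fun u _ => ?_
  rw [Finset.mul_sum]
  exact Finset.sum_congr rfl fun v _ => by ring

theorem signlessFormOn_le_abs (S : Finset V) (y : V → ℝ) :
    G.signlessFormOn S y ≤ G.signlessFormOn S fun v => |y v| := by
  unfold signlessFormOn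
  gcongr ?_ / 2
  refine Finset.sum_le_sum fun u _ => Finset.sum_le_sum fun v _ => ?_
  rw [← sq_abs (y u + y v)]
  gcongr
  exact abs_add_le _ _

theorem signlessFormOn_le (S : Finset V) (y : V → ℝ) :
    G.signlessFormOn S y ≤ 2 * S.card * ∑ v ∈ S, y v ^ 2 := by
  classical
  have h : ∑ u ∈ S, ∑ v ∈ S with G.Adj u v, (y u + y v) ^ 2 ≤
      ∑ u ∈ S, ∑ v ∈ S, (2 * y u ^ 2 + 2 * y v ^ 2) := by
    refine Finset.sum_le_sum fun u _ => ?_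
    calc ∑ v ∈ S with G.Adj u v, (y u + y v) ^ 2 ≤ ∑ v ∈ S, (y u + y v) ^ 2 :=
          Finset.sum_le_sum_of_subset_of_nonneg (Finset.filter_subset _ _)
            fun _ _ _ => sq_nonneg _
      _ ≤ _ := Finset.sum_le_sum fun v _ => by nlinarith [sq_nonneg (y u - y v)]
  simp only [Finset.sum_add_distrib, Finset.sum_const, nsmul_eq_mul, ← Finset.mul_sum] at h
  unfold signlessFormOn
  linarith

/-- The signless Laplacian form attains its maximum on the unit sphere at a nonnegative vector. -/
theorem exists_isMax_signlessFormOn {S : Finset V} (hS : S.Nonempty) :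
    ∃ y : V → ℝ, (∀ v, 0 ≤ y v) ∧ ∑ v ∈ S, y v ^ 2 = 1 ∧
      ∀ z : V → ℝ, G.signlessFormOn S z ≤ G.signlessFormOn S y * ∑ v ∈ S, z v ^ 2 := by
  classical
  let N : (V → ℝ) → ℝ := fun y => ∑ v ∈ S, y v ^ 2
  -- Coordinates outside `S` are unconstrained by `N`; the cube restores compactness. Nonnegative
  -- vectors suffice by `signlessFormOn_le_abs`.
  let K : Set (V → ℝ) := (Set.univ.pi fun _ => Set.Icc (0 : ℝ) 1) ∩ N ⁻¹' {1}
  have hNc : Continuous N := by fun_prop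
  have hK : IsCompact K :=
    (isCompact_univ_pi fun _ => isCompact_Icc).inter_right (isClosed_singleton.preimage hNc)
  have hKne : K.Nonempty := by
    obtain ⟨w, hw⟩ := hS
    refine ⟨fun v => if v = w then 1 else 0, fun v _ => ?_, ?_⟩
    · by_cases h : v = w <;> simp [h]
    · simp [N, hw]
  have hc : Continuous (G.signlessFormOn S) := by
    unfold signlessFormOn
    fun_prop
  obtain ⟨y, ⟨hy, hyN⟩, hmax⟩ := hK.exists_isMaxOn hKne hc.continuousOn
  refine ⟨y, fun v => (hy v trivial).1, hyN, fun z => ?_⟩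
  change _ ≤ _ * N z
  have hN0 : 0 ≤ N z := Finset.sum_nonneg fun _ _ => sq_nonneg _
  rcases hN0.eq_or_lt with h0 | h0
  · have hz : ∀ v ∈ S, z v = 0 := fun v hv =>
      pow_eq_zero_iff two_ne_zero |>.1
        ((Finset.sum_eq_zero_iff_of_nonneg fun _ _ => sq_nonneg _).1 h0.symm v hv)
    rw [← h0, mul_zero, G.signlessFormOn_congr (z := fun v => 0 * z v)
      fun v hv => by rw [hz v hv, zero_mul], signlessFormOn_smul]
    simp
  · let c := (Real.sqrt (N z))⁻¹
    have hc0 : 0 ≤ c := by positivity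
    have hc2 : c ^ 2 * N z = 1 := by
      simp only [c]
      rw [inv_pow, Real.sq_sqrt hN0, inv_mul_cancel₀ h0.ne']
    let w : V → ℝ := fun v => if v ∈ S then c * |z v| else 0
    have hw : ∀ v ∈ S, w v = c * |z v| := fun v hv => if_pos hv
    have hwN : N w = 1 := by
      rw [← hc2, Finset.mul_sum]
      exact Finset.sum_congr rfl fun v hv => by rw [hw v hv, mul_pow, sq_abs]
    have hwK : w ∈ K := by
      refine ⟨fun v _ => ?_, hwN⟩
      by_cases hv : v ∈ S
      · have h3 : w v ^ 2 ≤ N w :=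
          Finset.single_le_sum (f := fun v => w v ^ 2) (fun _ _ => sq_nonneg _) hv
        have h4 : 0 ≤ w v := by rw [hw v hv]; positivity
        exact ⟨h4, by nlinarith⟩
      · simp [w, hv]
    have h5 : G.signlessFormOn S w ≤ G.signlessFormOn S y := hmax hwK
    rw [G.signlessFormOn_congr hw, signlessFormOn_smul] at h5
    calc G.signlessFormOn S z ≤ G.signlessFormOn S fun v => |z v| := G.signlessFormOn_le_abs S z
      _ = c ^ 2 * G.signlessFormOn S (fun v => |z v|) * N z := by
        linear_combination (-G.signlessFormOn S fun v => |z v|) * hc2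
      _ ≤ _ := by gcongr

/-! ### Entries of a unit maximiser -/

open Classical in
/-- A maximiser of the form on the unit sphere is an eigenvector of the signless Laplacian. -/
theorem sum_add_eq_of_isMax {S : Finset V} {y : V → ℝ} (hy : ∑ v ∈ S, y v ^ 2 = 1)
    (hmax : ∀ z : V → ℝ, G.signlessFormOn S z ≤ G.signlessFormOn S y * ∑ v ∈ S, z v ^ 2)
    {u : V} (hu : u ∈ S) :
    ∑ v ∈ S with G.Adj u v, (y u + y v) = G.signlessFormOn S y * y u := by
  set q := G.signlessFormOn S y with hq
  set N := S.filter (G.Adj u)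
  -- Perturb the single coordinate `u` by `t`. Both sides vanish at `t = 0`, so the linear
  -- coefficients agree; below, the discriminant `4 * B ^ 2` must be nonpositive.
  have key : ∀ t : ℝ, 2 * t * ∑ v ∈ N, (y u + y v) + t ^ 2 * N.card ≤
      q * (2 * t * y u + t ^ 2) := by
    intro t
    have h := hmax (Function.update y u (y u + t))
    have hne : ∀ v ∈ N, v ≠ u := by
      rintro v hv rfl
      exact G.irrefl (Finset.mem_filter.1 hv).2
    have h1 : ∑ v ∈ S, Function.update y u (y u + t) v ^ 2 = 1 + 2 * t * y u + t ^ 2 := by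
      rw [← hy, ← Finset.add_sum_erase S _ hu, ← Finset.add_sum_erase S (fun v => y v ^ 2) hu,
        Finset.sum_congr rfl fun v hv => by
          rw [Function.update_of_ne (Finset.ne_of_mem_erase hv)]]
      simp only [Function.update_self]
      ring
    have h2 : G.signlessFormOn S (Function.update y u (y u + t)) =
        q + 2 * t * ∑ v ∈ N, (y u + y v) + t ^ 2 * N.card := by
      rw [hq, signlessFormOn_eq_erase_add G hu, signlessFormOn_eq_erase_add G hu,
        G.signlessFormOn_congr (z := y) fun v hv =>
          Function.update_of_ne (Finset.ne_of_mem_erase hv) _ _,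
        Finset.sum_congr rfl fun v hv => by
          rw [Function.update_self, Function.update_of_ne (hne v hv),
            show (y u + t + y v) ^ 2 = (y u + y v) ^ 2 + 2 * t * (y u + y v) + t ^ 2 by ring]]
      simp only [Finset.sum_add_distrib, ← Finset.mul_sum, Finset.sum_const, nsmul_eq_mul, N]
      ring
    rw [h1, h2] at h
    linarith
  set B := ∑ v ∈ N, (y u + y v) - q * y u with hB
  have h3 : ∀ t : ℝ, 0 ≤ (q - N.card) * (t * t) + (-2 * B) * t + 0 := fun t => by
    have := key t
    rw [hB]
    nlinarith
  have h4 := discrim_le_zero h3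
  simp only [discrim] at h4
  have h5 : B = 0 := by nlinarith [sq_nonneg B]
  linarith

open Classical in
/-- The smallest entry `y u` of a unit maximiser is bounded in terms of the degree of any vertex. -/
theorem sq_min_mul_le_degree {S : Finset V} {y : V → ℝ} (hy0 : ∀ v, 0 ≤ y v)
    (hy : ∑ v ∈ S, y v ^ 2 = 1)
    (hmax : ∀ z : V → ℝ, G.signlessFormOn S z ≤ G.signlessFormOn S y * ∑ v ∈ S, z v ^ 2)
    {u : V} (hmin : ∀ v ∈ S, y u ≤ y v) {w : V} (hw : w ∈ S) {d : ℝ}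
    (hd : d = (S.filter (G.Adj w)).card) (hdq : d ≤ G.signlessFormOn S y) :
    y u ^ 2 * ((G.signlessFormOn S y - d) ^ 2 + d * (S.card - d)) ≤ d := by
  set q := G.signlessFormOn S y
  set N := S.filter (G.Adj w)
  -- The eigenvalue equation at `w`, then Cauchy–Schwarz over its neighbours. The other `S.card - d`
  -- vertices each keep at least `y u ^ 2` of the unit mass.
  have h1 : ∑ v ∈ N, y v = (q - d) * y w := by
    have := G.sum_add_eq_of_isMax hy hmax hw
    rw [Finset.sum_add_distrib, Finset.sum_const, nsmul_eq_mul] at this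
    rw [hd]
    linarith
  have h2 : (∑ v ∈ N, y v) ^ 2 ≤ d * ∑ v ∈ N, y v ^ 2 := by
    rw [hd]
    exact sq_sum_le_card_mul_sum_sq
  have h3 : ∑ v ∈ N, y v ^ 2 ≤ 1 - (S.card - d) * y u ^ 2 := by
    have h4 := Finset.sum_filter_add_sum_filter_not S (G.Adj w) fun v => y v ^ 2
    have h5 : ((S.filter fun v => ¬ G.Adj w v).card : ℝ) * y u ^ 2 ≤
        ∑ v ∈ S with ¬ G.Adj w v, y v ^ 2 := by
      rw [← nsmul_eq_mul]
      refine Finset.card_nsmul_le_sum _ _ _ fun v hv => ?_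
      exact pow_le_pow_left₀ (hy0 u) (hmin v (Finset.mem_filter.1 hv).1) 2
    have h6 : ((S.filter fun v => ¬ G.Adj w v).card : ℝ) = S.card - d := by
      rw [hd, ← Finset.card_filter_add_card_filter_not (s := S) (G.Adj w)]
      push_cast
      ring
    rw [h6] at h5
    linarith
  have h7 : (q - d) * y u ≤ (q - d) * y w :=
    mul_le_mul_of_nonneg_left (hmin w hw) (by linarith)
  have h8 : ((q - d) * y u) ^ 2 ≤ ((q - d) * y w) ^ 2 :=
    pow_le_pow_left₀ (mul_nonneg (by linarith) (hy0 u)) h7 2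
  have hd0 : 0 ≤ d := by rw [hd]; positivity
  rw [h1] at h2
  nlinarith [mul_le_mul_of_nonneg_left h3 hd0]

open Classical in
/-- Removing a vertex with the smallest entry in a unit maximiser. -/
theorem signlessFormOn_erase_min_ge {S : Finset V} {y : V → ℝ} (hy0 : ∀ v, 0 ≤ y v)
    (hy : ∑ v ∈ S, y v ^ 2 = 1)
    (hmax : ∀ z : V → ℝ, G.signlessFormOn S z ≤ G.signlessFormOn S y * ∑ v ∈ S, z v ^ 2)
    {u : V} (hu : u ∈ S) (hmin : ∀ v ∈ S, y u ≤ y v) :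
    G.signlessFormOn S y - 1 - y u ^ 2 * (2 * G.signlessFormOn S y - S.card) ≤
      G.signlessFormOn (S.erase u) y := by
  set q := G.signlessFormOn S y with hq
  set N := S.filter (G.Adj u) with hN
  have h1 := G.signlessFormOn_eq_erase_add hu y
  have h2 := G.sum_add_eq_of_isMax hy hmax hu
  -- The form drops by this sum. After the eigenvalue equation is inserted, the degree of `u`
  -- cancels against the mass on its non-neighbours.
  have h3 : ∑ v ∈ N, (y u + y v) ^ 2 =
      2 * y u * ∑ v ∈ N, (y u + y v) - N.card * y u ^ 2 + ∑ v ∈ N, y v ^ 2 := by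
    rw [Finset.mul_sum, ← nsmul_eq_mul, ← Finset.sum_const, ← Finset.sum_sub_distrib,
      ← Finset.sum_add_distrib]
    exact Finset.sum_congr rfl fun v _ => by ring
  have h4 := Finset.sum_filter_add_sum_filter_not S (G.Adj u) fun v => y v ^ 2
  have h5 : ((S.filter fun v => ¬ G.Adj u v).card : ℝ) * y u ^ 2 ≤
      ∑ v ∈ S with ¬ G.Adj u v, y v ^ 2 := by
    rw [← nsmul_eq_mul]
    refine Finset.card_nsmul_le_sum _ _ _ fun v hv => ?_
    exact pow_le_pow_left₀ (hy0 u) (hmin v (Finset.mem_filter.1 hv).1) 2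
  have h6 : (S.card : ℝ) = N.card + (S.filter fun v => ¬ G.Adj u v).card := by
    rw [← Finset.card_filter_add_card_filter_not (s := S) (G.Adj u)]
    push_cast
    rfl
  rw [← hN] at h1 h2 h4
  rw [← hq, h3, h2] at h1
  rw [h6]
  nlinarith

/-! ### From a large form to a large minimum degree -/

/-- Lower bound for the smallest entry from the drop of the form on removing a vertex. -/
theorem le_of_normalised_drop {a b s t θ ε : ℝ} (ha : 1 / 2 ≤ a) (hε : 0 < ε) (hε1 : ε ≤ 1)
    (hθ : θ = ε ^ 2 / 4) (hb : a + ε ≤ b) (hb1 : b ≤ 1) (ht : t ≤ θ)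
    (h : 2 * b * (1 - θ) * (1 - t) ≤ 1 + (2 * b - 1) * s) : 1 - ε / 2 ≤ s := by
  have hθ0 : 0 < θ := by rw [hθ]; positivity
  have hθ1 : θ < 1 := by rw [hθ]; nlinarith
  have h1 : 2 * b * (1 - θ) * (1 - θ) ≤ 2 * b * (1 - θ) * (1 - t) :=
    mul_le_mul_of_nonneg_left (by linarith) (mul_nonneg (by linarith) (by linarith))
  have h2 : b * θ ≤ θ := mul_le_of_le_one_left hθ0.le hb1
  have h3 : 0 ≤ b * θ ^ 2 := mul_nonneg (by linarith) (sq_nonneg _)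
  -- The total loss is at most `4 * θ`, which is why `θ = ε ^ 2 / 4`: since `2 * b - 1 ≥ 2 * ε`, it
  -- follows that `1 - s ≤ ε / 2`.
  have h4 : (2 * b - 1) * (1 - s) ≤ ε ^ 2 := by
    rw [show ε ^ 2 = 4 * θ by rw [hθ]; ring]
    linarith
  by_contra! hlt
  have h5 : 2 * ε * (1 - s) ≤ (2 * b - 1) * (1 - s) :=
    mul_le_mul_of_nonneg_right (by linarith) (by linarith)
  nlinarith

/-- Lower bound for the degree from the smallest entry of the maximiser. -/
theorem le_of_normalised_degree {a b c s ε : ℝ} (ha : 1 / 2 ≤ a) (hε : 0 < ε) (hε1 : ε ≤ 1)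
    (hb : a + ε ≤ b) (hc1 : c ≤ 1) (hs : 1 - ε / 2 ≤ s)
    (h : s * (4 * b * (b - c) + c) ≤ c) : a + ε / 2 ≤ c := by
  -- Otherwise `b - c > ε / 2`, so `4 * b * (b - c) > ε`, and `h` gives `(1 - ε / 2) * ε < c * ε / 2
  -- ≤ ε / 2`, impossible for `ε ≤ 1`.
  by_contra! hlt
  have h1 : 2 * (b - c) ≤ 4 * b * (b - c) :=
    mul_le_mul_of_nonneg_right (by linarith) (by linarith)
  have h2 : (1 - ε / 2) * (4 * b * (b - c) + c) ≤ c :=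
    (mul_le_mul_of_nonneg_right hs (by linarith)).trans h
  have h3 : (1 - ε / 2) * ε < (1 - ε / 2) * (4 * b * (b - c)) :=
    mul_lt_mul_of_pos_left (by linarith) (by linarith)
  nlinarith

open Classical in
/-- A finite graph with large signless Laplacian form has a large induced subgraph with large
minimum degree. -/
theorem exists_subset_degree_ge {T : Finset V} {a ε : ℝ} (ha : 1 / 2 ≤ a) (hε : 0 < ε)
    (hε1 : ε ≤ 1) {x : V → ℝ} (hx : ∑ v ∈ T, x v ^ 2 = 1)
    (hT : 2 * T.card * (a + ε) ≤ G.signlessFormOn T x) :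
    ∃ S ⊆ T, (T.card : ℝ) ≤ 2 ^ (4 / ε ^ 2) * S.card ∧
      (4 / ε ^ 2 ≤ S.card → ∀ w ∈ S, (a + ε / 2) * S.card ≤ (S.filter (G.Adj w)).card) := by
  obtain ⟨θ, hθ⟩ : ∃ θ, θ = ε ^ 2 / 4 := ⟨_, rfl⟩
  have hθ0 : 0 < θ := by rw [hθ]; positivity
  have hθ1 : θ < 1 := by rw [hθ]; nlinarith
  have hθi : 4 / ε ^ 2 = 1 / θ := by rw [hθ]; field_simp
  have hTne : T.Nonempty := by
    rcases T.eq_empty_or_nonempty with rfl | h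
    · simp at hx
    · exact h
  have hq : ∀ S : Finset V, ∃ y : V → ℝ, S.Nonempty → (∀ v, 0 ≤ y v) ∧ ∑ v ∈ S, y v ^ 2 = 1 ∧
      ∀ z : V → ℝ, G.signlessFormOn S z ≤ G.signlessFormOn S y * ∑ v ∈ S, z v ^ 2 := by
    intro S
    by_cases hS : S.Nonempty
    · obtain ⟨y, hy⟩ := G.exists_isMax_signlessFormOn hS
      exact ⟨y, fun _ => hy⟩
    · exact ⟨0, fun h => absurd h hS⟩
  choose Y hY using hq
  -- The exponent `1 - θ` slightly favours large sets: the value at `T` forces `q / m ≥ 2 * (a + ε)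
  -- * (n / m) ^ θ`, and `q ≤ 2 * m` then gives `n ≤ 2 ^ (1 / θ) * m`.
  obtain ⟨S, hSmem, hSmax⟩ := Finset.exists_max_image (T.powerset.filter Finset.Nonempty)
    (fun S => G.signlessFormOn S (Y S) / (S.card : ℝ) ^ (1 - θ))
    ⟨T, by simp [hTne]⟩
  simp only [Finset.mem_filter, Finset.mem_powerset] at hSmem hSmax
  obtain ⟨hST, hS⟩ := hSmem
  obtain ⟨hy0, hy1, hymax⟩ := hY S hS
  obtain ⟨y, hyS⟩ : ∃ y, y = Y S := ⟨_, rfl⟩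
  obtain ⟨q, hqdef⟩ : ∃ q, q = G.signlessFormOn S y := ⟨_, rfl⟩
  rw [← hyS] at hy0 hy1 hymax
  rw [← hyS, ← hqdef] at hSmax
  obtain ⟨m, hm⟩ : ∃ m : ℝ, m = S.card := ⟨_, rfl⟩
  obtain ⟨n, hn⟩ : ∃ n : ℝ, n = T.card := ⟨_, rfl⟩
  have hm0 : 1 ≤ m := by rw [hm]; exact_mod_cast hS.card_pos
  have hn0 : 1 ≤ n := by rw [hn]; exact_mod_cast hTne.card_pos
  have hmq : m ≤ 2 * (a + ε) * m := le_mul_of_one_le_left (by linarith) (by linarith)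
  have hmn : m ≤ n := by
    rw [hm, hn]
    exact_mod_cast Finset.card_le_card hST
  rw [← hn] at hT
  have hq2 : q ≤ 2 * m := by
    have := G.signlessFormOn_le S y
    rwa [hy1, mul_one, ← hm, ← hqdef] at this
  have hpow : ∀ t : ℝ, 1 ≤ t → t = t ^ (1 - θ) * t ^ θ := fun t ht => by
    rw [← Real.rpow_add (by linarith)]
    simp
  have hmθ : 0 < m ^ (1 - θ) := by positivity
  have hnθ : 0 < n ^ (1 - θ) := by positivity
  have hmt : 0 < m ^ θ := by positivity
  have hnt : 0 < n ^ θ := by positivity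
  have hmnθ : m ^ θ ≤ n ^ θ := Real.rpow_le_rpow (by linarith) hmn hθ0.le
  have hratio : 2 * (a + ε) * n ^ θ ≤ q / m ^ (1 - θ) := by
    have h0 := hSmax T ⟨subset_rfl, hTne⟩
    rw [← hn, ← hm] at h0
    refine le_trans ?_ h0
    rw [le_div_iff₀ hnθ]
    have h1 := (hY T hTne).2.2 x
    rw [hx, mul_one] at h1
    refine le_trans (le_of_eq ?_) (hT.trans h1)
    have := hpow n hn0
    linear_combination (-2 * (a + ε)) * this
  rw [le_div_iff₀ hmθ] at hratio
  have hb : 2 * (a + ε) * m ≤ q := by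
    refine le_trans ?_ hratio
    have := hpow m hm0
    calc 2 * (a + ε) * m = 2 * (a + ε) * m ^ θ * m ^ (1 - θ) := by
          linear_combination (2 * (a + ε)) * this
      _ ≤ _ := by gcongr
  refine ⟨S, hST, ?_, ?_⟩
  all_goals rw [← hm]
  · rw [← hn]
    have h1 : n ^ θ ≤ 2 * m ^ θ := by
      have h2 : n ^ θ * m ^ (1 - θ) ≤ 2 * m ^ θ * m ^ (1 - θ) := by
        have := hpow m hm0
        have h3 : n ^ θ * m ^ (1 - θ) ≤ 2 * (a + ε) * (n ^ θ * m ^ (1 - θ)) :=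
          le_mul_of_one_le_left (by positivity) (by linarith)
        linarith
      exact le_of_mul_le_mul_right h2 hmθ
    have h3 : (n ^ θ) ^ (1 / θ) ≤ (2 * m ^ θ) ^ (1 / θ) :=
      Real.rpow_le_rpow hnt.le h1 (by positivity)
    rw [Real.mul_rpow (by norm_num) hmt.le, ← Real.rpow_mul (by linarith),
      ← Real.rpow_mul (by linarith), mul_one_div_cancel hθ0.ne', Real.rpow_one,
      Real.rpow_one] at h3
    rwa [hθi]
  · intro hlarge w hw
    rw [hθi] at hlarge
    have hθm : 1 ≤ θ * m := by
      rw [div_le_iff₀ hθ0] at hlarge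
      linarith
    obtain ⟨u, hu, hmin⟩ := S.exists_min_image y hS
    have hum : m * y u ^ 2 ≤ 1 := by
      rw [← hy1, hm, ← nsmul_eq_mul]
      exact Finset.card_nsmul_le_sum _ _ _ fun v hv => pow_le_pow_left₀ (hy0 u) (hmin v hv) 2
    have hm1 : 1 < m := hθm.trans_lt (mul_lt_of_lt_one_left (by linarith) hθ1)
    have hdrop : G.signlessFormOn (S.erase u) y ≤ (q - q * (1 - θ) / m) * (1 - y u ^ 2) := by
      have hcard : ((S.erase u).card : ℝ) = m - 1 := by
        rw [Finset.card_erase_of_mem hu, Nat.cast_sub hS.card_pos]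
        simp [hm]
      have hne : (S.erase u).Nonempty := by
        rw [← Finset.card_pos]
        have : (0 : ℝ) < (S.erase u).card := by rw [hcard]; linarith
        exact_mod_cast this
      have h1 := (hY _ hne).2.2 y
      have h2 := hSmax (S.erase u) ⟨(Finset.erase_subset _ _).trans hST, hne⟩
      rw [hcard, ← hm, div_le_div_iff₀ (Real.rpow_pos_of_pos (by linarith) _) hmθ] at h2
      -- Bernoulli's inequality for an exponent in `[0, 1]`.
      have h3 : (m - 1) ^ (1 - θ) ≤ (1 - (1 - θ) / m) * m ^ (1 - θ) := by
        have h4 : m - 1 = (1 + -(1 / m)) * m := by field_simp; ring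
        have h5 : 1 / m ≤ 1 := by rw [div_le_one (by linarith)]; linarith
        rw [h4, Real.mul_rpow (by linarith) (by linarith)]
        refine mul_le_mul_of_nonneg_right ?_ hmθ.le
        refine (rpow_one_add_le_one_add_mul_self (by linarith) (by linarith)
          (by linarith)).trans (le_of_eq ?_)
        ring
      have h6 : G.signlessFormOn (S.erase u) (Y (S.erase u)) ≤ q - q * (1 - θ) / m := by
        refine le_of_mul_le_mul_right (h2.trans ?_) hmθ
        have hq0 : 0 ≤ q := hqdef ▸ G.signlessFormOn_nonneg _ _
        refine (mul_le_mul_of_nonneg_left h3 hq0).trans (le_of_eq ?_)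
        ring
      have h7 : ∑ v ∈ S.erase u, y v ^ 2 = 1 - y u ^ 2 := by
        rw [← hy1, ← Finset.add_sum_erase S (fun v => y v ^ 2) hu]
        ring
      rw [h7] at h1
      refine h1.trans (mul_le_mul_of_nonneg_right h6 ?_)
      nlinarith [sq_nonneg (y u)]
    -- Against the upper bound `hdrop`, this shows that `m * y u ^ 2` is not much below `1`, its
    -- largest possible value.
    have hkeep := G.signlessFormOn_erase_min_ge hy0 hy1 hymax hu hmin
    rw [← hqdef, ← hm] at hkeep
    obtain ⟨b, hbq⟩ : ∃ b, q = 2 * b * m := ⟨q / (2 * m), by field_simp⟩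
    obtain ⟨s, hsy⟩ : ∃ s, s = m * y u ^ 2 := ⟨_, rfl⟩
    have hs0 : 0 ≤ s := by rw [hsy]; positivity
    have hba : a + ε ≤ b := by
      rw [hbq] at hb
      have := le_of_mul_le_mul_right hb (by linarith)
      linarith
    have hb1 : b ≤ 1 := by
      rw [hbq] at hq2
      have := le_of_mul_le_mul_right hq2 (by linarith)
      linarith
    -- `s` is the normalised square of the smallest entry
    have hs : 1 - ε / 2 ≤ s := by
      have h1 : 2 * b * (1 - θ) * (1 - y u ^ 2) ≤ 1 + (2 * b - 1) * s := by
        have h2 : q * (1 - θ) / m = 2 * b * (1 - θ) := by rw [hbq]; field_simp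
        rw [h2] at hdrop
        have h3 := hkeep.trans hdrop
        rw [hbq] at h3
        rw [hsy]
        linarith
      have h4 : y u ^ 2 ≤ θ := by
        calc y u ^ 2 ≤ (θ * m) * y u ^ 2 := le_mul_of_one_le_left (sq_nonneg _) hθm
          _ = θ * (m * y u ^ 2) := by ring
          _ ≤ θ := mul_le_of_le_one_right hθ0.le hum
      exact le_of_normalised_drop ha hε hε1 hθ hba hb1 h4 h1
    obtain ⟨d, hd⟩ : ∃ d : ℝ, d = (S.filter (G.Adj w)).card := ⟨_, rfl⟩
    have hdm : d ≤ m := by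
      rw [hd, hm]
      exact_mod_cast Finset.card_filter_le _ _
    have hdq : d ≤ q := by linarith
    have hdeg := G.sq_min_mul_le_degree hy0 hy1 hymax hmin hw hd (hdq.trans_eq hqdef)
    rw [← hqdef, ← hm] at hdeg
    rw [← hd]
    obtain ⟨c, hcd⟩ : ∃ c, d = c * m := ⟨d / m, (div_mul_cancel₀ d (by linarith)).symm⟩
    have hc1 : c ≤ 1 := by
      rw [hcd] at hdm
      exact le_of_mul_le_mul_right (hdm.trans_eq (one_mul m).symm) (by linarith)
    have h8 : s * (4 * b * (b - c) + c) ≤ c := by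
      have h9 : m * (s * (4 * b * (b - c) + c)) ≤ m * c := by
        rw [hbq, hcd] at hdeg
        rw [hsy]
        linarith
      exact le_of_mul_le_mul_left h9 (by linarith)
    rw [hcd]
    exact mul_le_mul_of_nonneg_right
      (le_of_normalised_degree ha hε hε1 hba hc1 hs h8) (by linarith)

/-! ### Erdős–Stone for the signless Laplacian form -/

/-- Erdős–Stone theorem for the signless Laplacian form. -/
theorem exists_completeEquipartite_of_signlessFormOn (k L : ℕ) (hk : 2 ≤ k) {ε : ℝ} (hε : 0 < ε)
    (hε1 : ε ≤ 1) :
    ∃ n₀ : ℕ, ∀ {V : Type*} (G : SimpleGraph V) (T : Finset V) (x : V → ℝ), n₀ ≤ T.card →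
      ∑ v ∈ T, x v ^ 2 = 1 → 2 * T.card * (1 - 1 / (k : ℝ) + ε) ≤ G.signlessFormOn T x →
      ∃ f : Fin (k + 1) × Fin L → V, Function.Injective f ∧ (∀ p, f p ∈ T) ∧
        ∀ p q, p.1 ≠ q.1 → G.Adj (f p) (f q) := by
  classical
  obtain ⟨N, hN⟩ := Filter.eventually_atTop.1
    (eventually_completeEquipartiteGraph_isContained_of_minDegree (half_pos hε) k L)
  set c : ℝ := 2 ^ (4 / ε ^ 2)
  have hc : 0 < c := by positivity
  -- Since `S` has at least `T.card / c` vertices, it is nonempty and large enough both for its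
  -- degree bound and for the minimum-degree theorem with `ε / 2`.
  refine ⟨⌈c * max (max (N : ℝ) 1) (4 / ε ^ 2)⌉₊, fun {V} G T x hT hx hq => ?_⟩
  have ha : (1 : ℝ) / 2 ≤ 1 - 1 / (k : ℝ) := by
    have : (1 : ℝ) / k ≤ 1 / 2 := one_div_le_one_div_of_le two_pos (by exact_mod_cast hk)
    linarith
  obtain ⟨S, hST, hTS, hdeg⟩ := G.exists_subset_degree_ge ha hε hε1 hx hq
  have hS : max (max (N : ℝ) 1) (4 / ε ^ 2) ≤ S.card :=
    le_of_mul_le_mul_left ((Nat.ceil_le.1 hT).trans hTS) hc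
  have hSN : N ≤ S.card := by
    exact_mod_cast ((le_max_left _ _).trans (le_max_left _ _)).trans hS
  have hS1 : 1 ≤ S.card := by
    exact_mod_cast ((le_max_right _ _).trans (le_max_left _ _)).trans hS
  have hd := hdeg ((le_max_right _ _).trans hS)
  let e : Fin S.card ≃ S := S.equivFin.symm
  let g : Fin S.card → V := fun i => e i
  have hg : Function.Injective g := Subtype.val_injective.comp e.injective
  have : Nonempty (Fin S.card) := ⟨⟨0, hS1⟩⟩
  have hmin : ((G.comap g).minDegree : ℝ) ≥ (1 - 1 / k + ε / 2) * S.card := by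
    obtain ⟨v, hv⟩ := (G.comap g).exists_minimal_degree_vertex
    rw [hv]
    refine (hd (g v) (e v).2).trans_eq ?_
    rw [← card_neighborFinset_eq_degree, ← Finset.card_map ⟨g, hg⟩]
    congr 2
    ext w
    simp only [Finset.mem_filter, Finset.mem_map, mem_neighborFinset, comap_adj,
      Function.Embedding.coeFn_mk]
    constructor
    · rintro ⟨hw, h⟩
      refine ⟨e.symm ⟨w, hw⟩, ?_, ?_⟩ <;> simp [g, h]
    · rintro ⟨i, hi, rfl⟩
      exact ⟨(e i).2, hi⟩
  obtain ⟨φ⟩ := hN S.card hSN hmin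
  refine ⟨fun p => g (φ p), hg.comp φ.injective, fun p => hST (e _).2, fun p q hpq => ?_⟩
  exact φ.toHom.map_adj (v := p) (w := q) hpq

end SimpleGraph

/-! ### From a linear hypergraph to its shadow -/

namespace Hypergraph

variable {α : Type*}

/-- The graph joining any two distinct vertices that lie in a common edge. -/
def shadow (H : Hypergraph α) : SimpleGraph α where
  Adj u v := u ≠ v ∧ ∃ e ∈ H.edgeSet, u ∈ e ∧ v ∈ e
  symm := ⟨fun _ _ ⟨h, e, he, hu, hv⟩ => ⟨h.symm, e, he, hv, hu⟩⟩
  loopless := ⟨fun _ h => h.1 rfl⟩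

open Finset in
/-- The arithmetic–geometric mean inequality over ordered pairs. -/
theorem card_mul_prod_le_sum_sq [DecidableEq α] (s : Finset α) (hs : 2 ≤ s.card) (x y : α → ℝ)
    (hx : ∀ v, 0 ≤ x v) (hy : ∀ v, 0 ≤ y v) (hxy : ∀ v, y v ^ 2 = x v ^ s.card) :
    (s.card - 1) * ∑ v ∈ s, y v ^ 2 + s.card * (s.card - 1) * ∏ v ∈ s, x v ≤
      (∑ p ∈ s.offDiag, (y p.1 + y p.2) ^ 2) / 2 := by
  set r := s.card with hr
  have hoff : (#s.offDiag : ℝ) = r * (r - 1) := by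
    rw [offDiag_card, ← hr, Nat.cast_sub (Nat.le_mul_self r)]
    push_cast
    ring
  have hsplit : ∀ f : α × α → ℝ, ∑ p ∈ s.offDiag, f p = ∑ p ∈ s ×ˢ s, f p - ∑ v ∈ s, f (v, v) := by
    intro f
    rw [← diag_union_offDiag, sum_union (disjoint_diag_offDiag s), sum_diag]
    ring
  have h1 : ∑ p ∈ s.offDiag, (y p.1 + y p.2) ^ 2 =
      2 * ((r - 1) * ∑ v ∈ s, y v ^ 2) + 2 * ∑ p ∈ s.offDiag, y p.1 * y p.2 := by
    rw [hsplit, hsplit, sum_product, sum_product]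
    simp only [add_sq, sum_add_distrib, sum_const, nsmul_eq_mul, ← mul_sum, ← sum_mul, ← hr,
      mul_assoc, ← sq]
    ring
  have hP0 : 0 ≤ ∏ v ∈ s, x v := prod_nonneg fun v _ => hx v
  have h2 : r * (r - 1) * ∏ v ∈ s, x v ≤ ∑ p ∈ s.offDiag, y p.1 * y p.2 := by
    have hr2 : (2 : ℝ) ≤ r := by exact_mod_cast hs
    have hpos : (0 : ℝ) < r * (r - 1) := mul_pos (by linarith) (by linarith)
    rcases hP0.eq_or_lt with h0 | h0
    · rw [← h0, mul_zero]
      exact sum_nonneg fun p _ => mul_nonneg (hy _) (hy _)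
    · have hyP : (∏ v ∈ s, y v) ^ 2 = (∏ v ∈ s, x v) ^ r := by
        rw [← prod_pow, ← prod_pow]
        exact prod_congr rfl fun v _ => hxy v
      -- Each vertex occurs `2 * (r - 1)` times in the ordered pairs and `y v ^ 2 = x v ^ r`, so the
      -- geometric mean of the `r * (r - 1)` products is exactly `∏ v ∈ s, x v`.
      have hprod : ∏ p ∈ s.offDiag, y p.1 * y p.2 = (∏ v ∈ s, x v) ^ #s.offDiag := by
        have h3 : (∏ v ∈ s, y v * y v) * ∏ p ∈ s.offDiag, y p.1 * y p.2 =
            ((∏ v ∈ s, x v) ^ r) ^ r := by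
          have : ∏ p ∈ s ×ˢ s, y p.1 * y p.2 = ((∏ v ∈ s, y v) ^ 2) ^ r := by
            rw [prod_product]
            simp only [prod_mul_distrib, prod_const, ← hr]
            rw [prod_pow]
            ring
          rw [← hyP, ← this, ← diag_union_offDiag, prod_union (disjoint_diag_offDiag s), prod_diag]
        rw [prod_mul_distrib, ← sq, hyP] at h3
        have h4 : (∏ v ∈ s, x v) ^ r ≠ 0 := (pow_pos h0 r).ne'
        apply mul_left_cancel₀ h4
        rw [h3, ← pow_mul, ← pow_add, offDiag_card, ← hr,
          Nat.add_sub_of_le (Nat.le_mul_self r)]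
      have := Real.geom_mean_le_arith_mean s.offDiag (fun _ => 1) (fun p => y p.1 * y p.2)
        (fun _ _ => zero_le_one) (by simp only [sum_const, nsmul_eq_mul, mul_one]; rwa [hoff])
        fun p _ => mul_nonneg (hy _) (hy _)
      simp only [Real.rpow_one, sum_const, nsmul_eq_mul, mul_one, one_mul, hprod] at this
      have hne : #s.offDiag ≠ 0 := by
        intro h
        rw [h] at hoff
        simp only [Nat.cast_zero] at hoff
        linarith
      rw [Real.pow_rpow_inv_natCast hP0 hne, hoff, le_div_iff₀ hpos] at this
      linarith
  rw [h1]
  linarith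

open Finset in
/-- The signless Laplacian form of a linear `r`-uniform hypergraph is bounded by that of its
shadow. -/
theorem signlessForm_le_shadow (H : Hypergraph α) (hfin : H.vertexSet.Finite) {r : ℕ}
    (hr : 2 ≤ r) (hu : H.IsUniform r) (hl : H.IsLinear) (x : α → ℝ) :
    (r - 1) * H.signlessForm r x ≤
      H.shadow.signlessFormOn hfin.toFinset fun v => Real.sqrt (|x v| ^ r) := by
  classical
  set T := hfin.toFinset
  set y : α → ℝ := fun v => Real.sqrt (|x v| ^ r)
  have hy : ∀ v, y v ^ 2 = |x v| ^ r := fun v => Real.sq_sqrt (by positivity)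
  let F : Finset (Finset α) := T.powerset.filter fun s => (s : Set α) ∈ H.edgeSet
  have hF : ∀ s ∈ F, s ⊆ T ∧ (s : Set α) ∈ H.edgeSet := fun s hs => by
    simpa [F] using hs
  have hcard : ∀ s ∈ F, #s = r := fun s hs => by
    rw [← hu _ (hF s hs).2, Set.ncard_coe_finset]
  have hinj : Function.Injective ((↑) : Finset α → Set α) := Finset.coe_injective
  have himage : H.edgeSet = (↑) '' (F : Set (Finset α)) := by
    ext e
    constructor
    · intro he
      have hsub := H.subset_vertexSet_of_mem_edgeSet' he
      refine ⟨(hfin.subset hsub).toFinset, ?_, by simp⟩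
      simp only [F, coe_filter, mem_powerset, Set.mem_ofPred_eq, Set.Finite.coe_toFinset]
      exact ⟨Set.Finite.toFinset_subset_toFinset.2 hsub, he⟩
    · rintro ⟨s, hs, rfl⟩
      exact (hF s hs).2
  have hdeg : ∀ v, H.degree v = #(F.filter (v ∈ ·)) := by
    intro v
    rw [degree, ← Set.ncard_coe_finset, ← Set.ncard_image_of_injective _ hinj]
    congr 1
    ext e
    simp only [himage, Set.mem_ofPred_eq, Set.mem_image, mem_coe, mem_filter]
    constructor
    · rintro ⟨⟨s, hs, rfl⟩, hv⟩
      exact ⟨s, ⟨hs, hv⟩, rfl⟩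
    · rintro ⟨s, ⟨hs, hv⟩, rfl⟩
      exact ⟨⟨s, hs, rfl⟩, hv⟩
  have hform : H.signlessForm r x ≤ ∑ s ∈ F, (∑ v ∈ s, y v ^ 2 + r * ∏ v ∈ s, |x v|) := by
    rw [signlessForm, himage, finsum_mem_image hinj.injOn, finsum_mem_coe_finset,
      finsum_mem_eq_finite_toFinset_sum _ hfin, sum_add_distrib, ← mul_sum]
    have h1 : ∑ v ∈ T, (H.degree v : ℝ) * x v ^ r ≤ ∑ s ∈ F, ∑ v ∈ s, y v ^ 2 := by
      rw [sum_comm' (t' := T) (s' := fun v => F.filter (v ∈ ·))]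
      · refine sum_le_sum fun v _ => ?_
        rw [sum_const, nsmul_eq_mul, hdeg, hy]
        exact mul_le_mul_of_nonneg_left ((le_abs_self _).trans_eq (abs_pow _ _)) (Nat.cast_nonneg _)
      · intro s v
        simp only [mem_filter]
        exact ⟨fun h => ⟨⟨h.1, h.2⟩, (hF s h.1).1 h.2⟩, fun h => h.1⟩
    gcongr with s hs
    rw [finprod_mem_coe_finset, ← abs_prod]
    exact le_abs_self _
  have hr1 : (0 : ℝ) ≤ r - 1 := by
    have : (2 : ℝ) ≤ r := by exact_mod_cast hr
    linarith
  -- Linearity enters here: no pair is counted by two edges.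
  have hdisj : (F : Set (Finset α)).PairwiseDisjoint offDiag := by
    intro s hs t ht hst
    refine disjoint_left.2 fun p hps hpt => ?_
    rw [mem_offDiag] at hps hpt
    exact hps.2.2 (hl (hF s hs).2 (hF t ht).2 (hinj.ne hst) ⟨hps.1, hpt.1⟩ ⟨hps.2.1, hpt.2.1⟩)
  calc (r - 1) * H.signlessForm r x
      ≤ (r - 1) * ∑ s ∈ F, (∑ v ∈ s, y v ^ 2 + r * ∏ v ∈ s, |x v|) := by gcongr
    _ ≤ ∑ s ∈ F, (∑ p ∈ s.offDiag, (y p.1 + y p.2) ^ 2) / 2 := by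
      rw [mul_sum]
      refine sum_le_sum fun s hs => ?_
      have := card_mul_prod_le_sum_sq s (by rw [hcard s hs]; exact hr) (fun v => |x v|) y
        (fun _ => abs_nonneg _) (fun _ => Real.sqrt_nonneg _)
        (fun v => by rw [hcard s hs]; exact hy v)
      rw [hcard s hs] at this
      linarith
    _ = (∑ p ∈ F.biUnion offDiag, (y p.1 + y p.2) ^ 2) / 2 := by
      rw [sum_biUnion hdisj, sum_div]
    _ ≤ (∑ p ∈ T ×ˢ T with H.shadow.Adj p.1 p.2, (y p.1 + y p.2) ^ 2) / 2 := by
      gcongr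
      intro p hp
      obtain ⟨s, hs, hps⟩ := mem_biUnion.1 hp
      rw [mem_offDiag] at hps
      rw [mem_filter, mem_product]
      exact ⟨⟨(hF s hs).1 hps.1, (hF s hs).1 hps.2.1⟩, hps.2.2, s, (hF s hs).2, hps.1, hps.2.1⟩
    _ = _ := by
      rw [SimpleGraph.signlessFormOn, sum_filter, sum_product]
      simp only [sum_filter]

/-! ### Pair-sparse sets and their greedy construction -/

/-- A set of vertices that meets every edge in at most two vertices, and such that two distinct
edges that meet it in two vertices each share no vertex outside it. -/
def IsPairSparse (H : Hypergraph α) (S : Set α) : Prop :=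
  (∀ e ∈ H.edgeSet, ∀ u ∈ S, ∀ v ∈ S, ∀ w ∈ S, u ∈ e → v ∈ e → w ∈ e → u ≠ v → w = u ∨ w = v) ∧
    ∀ e ∈ H.edgeSet, ∀ f ∈ H.edgeSet, e ≠ f → (e ∩ S).Nontrivial → (f ∩ S).Nontrivial → e ∩ f ⊆ S

/-- `C` contains `S` and every edge that meets `S` in at least two vertices. -/
def AbsorbsPairs (H : Hypergraph α) (S C : Set α) : Prop :=
  S ⊆ C ∧ ∀ e ∈ H.edgeSet, (e ∩ S).Nontrivial → e ⊆ C

/-- By linearity each of the `S.card ^ 2` ordered pairs determines at most one edge, which adds at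
most `r` vertices. -/
theorem exists_absorbsPairs {H : Hypergraph α} {r : ℕ} (hr : 2 ≤ r) (hu : H.IsUniform r)
    (hl : H.IsLinear) (S : Finset α) :
    ∃ C : Finset α, H.AbsorbsPairs S C ∧ C.card ≤ S.card + S.card ^ 2 * r := by
  classical
  have hφ : ∀ p : α × α, ∃ s : Finset α, s.card ≤ r ∧
      ∀ e ∈ H.edgeSet, p.1 ≠ p.2 → p.1 ∈ e → p.2 ∈ e → e ⊆ s := by
    intro p
    by_cases h : ∃ e ∈ H.edgeSet, p.1 ≠ p.2 ∧ p.1 ∈ e ∧ p.2 ∈ e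
    · obtain ⟨e, he, hne, h1, h2⟩ := h
      have hfin : e.Finite := Set.finite_of_ncard_ne_zero (by rw [hu e he]; omega)
      refine ⟨hfin.toFinset, ?_, fun f hf _ hf1 hf2 => ?_⟩
      · rw [← Set.ncard_eq_toFinset_card e hfin, hu e he]
      · rw [Set.Finite.coe_toFinset]
        by_contra hfe
        have hfe' : f ≠ e := fun h => hfe h.subset
        exact hne (hl hf he hfe' ⟨hf1, h1⟩ ⟨hf2, h2⟩)
    · exact ⟨∅, by simp, fun e he hne h1 h2 => absurd ⟨e, he, hne, h1, h2⟩ h⟩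
  choose φ hφr hφe using hφ
  refine ⟨S ∪ (S ×ˢ S).biUnion φ, ⟨by simp, ?_⟩, ?_⟩
  · rintro e he ⟨u, ⟨hue, huS⟩, v, ⟨hve, hvS⟩, huv⟩
    refine (hφe (u, v) e he huv hue hve).trans ?_
    rw [Finset.coe_subset]
    exact (Finset.subset_biUnion_of_mem φ (Finset.mk_mem_product huS hvS)).trans
      Finset.subset_union_right
  · refine (Finset.card_union_le _ _).trans (Nat.add_le_add_left ?_ _)
    refine (Finset.card_biUnion_le_card_mul _ _ r fun p _ => hφr p).trans_eq ?_
    rw [Finset.card_product, sq]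

/-- Absorbing twice is what makes `w` safe. An edge through `w` cannot meet `C` twice, as it would
lie in `D`. If it met `S` in `u` and shared a vertex `z ∉ S` with an edge meeting `S` twice, that
second edge would lie in `C`, so the first would meet `C` in both `u` and `z`. Two edges through `w`
share only `w`. -/
theorem IsPairSparse.insert {H : Hypergraph α} (hl : H.IsLinear) {S C D : Set α}
    (hS : H.IsPairSparse S) (hC : H.AbsorbsPairs S C) (hD : H.AbsorbsPairs C D) {w : α}
    (hw : w ∉ D) : H.IsPairSparse (insert w S) := by
  have hnt : ∀ {e : Set α} {A : Set α} {u v : α}, u ∈ e → u ∈ A → v ∈ e → v ∈ A → u ≠ v →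
      (e ∩ A).Nontrivial := fun h1 h2 h3 h4 h => ⟨_, ⟨h1, h2⟩, _, ⟨h3, h4⟩, h⟩
  have hwe : ∀ e ∈ H.edgeSet, w ∈ e → ¬ (e ∩ C).Nontrivial := fun e he hwe h =>
    hw (hD.2 e he h hwe)
  have hwS : ∀ e ∈ H.edgeSet, w ∈ e → ∀ u ∈ S, ∀ v ∈ S, u ∈ e → v ∈ e → u = v := by
    intro e he hwe' u hu v hv hue hve
    by_contra h
    exact hwe e he hwe' (hnt hue (hC.1 hu) hve (hC.1 hv) h)
  have hold : ∀ e ∈ H.edgeSet, w ∉ e → (e ∩ Insert.insert w S).Nontrivial →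
      (e ∩ S).Nontrivial := by
    rintro e _ hwe' ⟨u, ⟨hue, hu⟩, v, ⟨hve, hv⟩, huv⟩
    refine hnt hue (hu.resolve_left ?_) hve (hv.resolve_left ?_) huv
    · rintro rfl; exact hwe' hue
    · rintro rfl; exact hwe' hve
  have hmix : ∀ e ∈ H.edgeSet, ∀ f ∈ H.edgeSet, w ∈ e → w ∉ f →
      (e ∩ Insert.insert w S).Nontrivial → (f ∩ Insert.insert w S).Nontrivial →
      e ∩ f ⊆ Insert.insert w S := by
    intro e he f hf hwe' hwf hen hfn z hz
    have hfC := hC.2 f hf (hold f hf hwf hfn)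
    obtain ⟨u, ⟨hue, hu⟩, huw⟩ := hen.exists_ne w
    have huS : u ∈ S := hu.resolve_left huw
    by_contra hzS
    refine hwe e he hwe' (hnt hz.1 (hfC hz.2) hue (hC.1 huS) ?_)
    rintro rfl
    exact hzS hu
  constructor
  · intro e he u hu v hv x hx hue hve hxe huv
    by_cases hwe' : w ∈ e
    · have := hwS e he hwe'
      rcases hu with rfl | hu <;> rcases hv with rfl | hv <;> rcases hx with rfl | hx
      all_goals first
        | exact absurd rfl huv
        | exact Or.inl rfl
        | exact Or.inr rfl
        | exact absurd (this _ hu _ hv hue hve) huv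
        | exact Or.inl (this _ hx _ hu hxe hue)
        | exact Or.inr (this _ hx _ hv hxe hve)
    · have hS' : ∀ a ∈ Insert.insert w S, a ∈ e → a ∈ S := fun a ha hae =>
        ha.resolve_left fun h => hwe' (h ▸ hae)
      exact hS.1 e he u (hS' u hu hue) v (hS' v hv hve) x (hS' x hx hxe) hue hve hxe huv
  · intro e he f hf hef hen hfn
    by_cases hwe' : w ∈ e <;> by_cases hwf : w ∈ f
    · intro z hz
      exact Or.inl (hl he hf hef hz ⟨hwe', hwf⟩)
    · exact hmix e he f hf hwe' hwf hen hfn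
    · rw [Set.inter_comm]
      exact hmix f hf e he hwf hwe' hfn hen
    · exact (hS.2 e he f hf hef (hold e he hwe' hen) (hold f hf hwf hfn)).trans
        (Set.subset_insert _ _)

/-- A pair-sparse system of distinct representatives of sufficiently large sets. -/
theorem exists_pairSparse_representatives [Nonempty α] {H : Hypergraph α} {r : ℕ} (hr : 2 ≤ r)
    (hu : H.IsUniform r) (hl : H.IsLinear) {ι : Type*} (I : Finset ι) (A : ι → Finset α) {m M : ℕ}
    (hm : I.card ≤ m) (hM : (m + m ^ 2 * r) + (m + m ^ 2 * r) ^ 2 * r < M)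
    (hA : ∀ i ∈ I, M ≤ (A i).card) :
    ∃ g : ι → α, (∀ i ∈ I, g i ∈ A i) ∧ Set.InjOn g I ∧ H.IsPairSparse (g '' I) := by
  classical
  induction I using Finset.induction_on with
  | empty =>
    obtain ⟨a⟩ := ‹Nonempty α›
    exact ⟨fun _ => a, by simp, by simp, by simp [IsPairSparse]⟩
  | insert i I hi ih =>
    rw [Finset.card_insert_of_notMem hi] at hm
    obtain ⟨g, hgA, hginj, hg⟩ := ih (by omega) fun j hj => hA j (Finset.mem_insert_of_mem hj)
    obtain ⟨C, hC, hCcard⟩ := exists_absorbsPairs hr hu hl (I.image g)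
    obtain ⟨D, hD, hDcard⟩ := exists_absorbsPairs hr hu hl C
    have hIm : (I.image g).card ≤ m := Finset.card_image_le.trans (by omega)
    have hCm : C.card ≤ m + m ^ 2 * r := hCcard.trans (by gcongr)
    -- `M` exceeds the size of the double closure of any `m` vertices, so `A i` has a vertex outside
    -- `D`; it is new because the earlier choices lie in `D`.
    have hDm : D.card < (A i).card :=
      (hDcard.trans (by gcongr)).trans_lt (hM.trans_le (hA i (Finset.mem_insert_self i I)))
    obtain ⟨w, hwA, hwD⟩ := Finset.exists_mem_notMem_of_card_lt_card hDm
    have hne : ∀ j ∈ I, j ≠ i := fun j hj h => hi (h ▸ hj)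
    have hupd : ∀ j ∈ I, Function.update g i w j = g j := fun j hj =>
      Function.update_of_ne (hne j hj) _ _
    have himage : Function.update g i w '' (I : Set ι) = g '' I := Set.image_congr hupd
    refine ⟨Function.update g i w, ?_, ?_, ?_⟩
    · intro j hj
      rcases Finset.mem_insert.1 hj with rfl | hj
      · rwa [Function.update_self]
      · rw [hupd j hj]
        exact hgA j hj
    · rw [Finset.coe_insert, Set.injOn_insert (by simpa using hi), himage, Function.update_self]
      refine ⟨hginj.congr fun j hj => (hupd j hj).symm, fun hw => hwD (hD.1 (hC.1 ?_))⟩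
      rwa [Finset.coe_image]
    · rw [Finset.coe_insert, Set.image_insert_eq, himage, Function.update_self,
        ← Finset.coe_image]
      rw [← Finset.coe_image] at hg
      exact hg.insert hl hC hD hwD

/-! ### Extending a copy in the shadow to the expansion -/

/-- A pair-sparse copy of a graph in the shadow extends to a copy of its expansion. -/
theorem containsCopy_expansion_of_pairSparse {β : Type*} {H : Hypergraph α} {r : ℕ} (hr : 2 ≤ r)
    (hu : H.IsUniform r) {F : SimpleGraph β} {g : β → α} (hg : Function.Injective g)
    (hgV : ∀ b, g b ∈ H.vertexSet) (hadj : ∀ a b, F.Adj a b → H.shadow.Adj (g a) (g b))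
    (hS : H.IsPairSparse (Set.range g)) : H.ContainsCopy (expansion F r) := by
  classical
  -- `h` is a hyperedge through the images of the ends of `e`, and `ψ` enumerates its remaining `r -
  -- 2` vertices, none of them in the copy.
  have hedge : ∀ e : F.edgeSet, ∃ (h : Set α) (ψ : Fin (r - 2) → α), h ∈ H.edgeSet ∧
      Function.Injective ψ ∧ g '' {v : β | v ∈ (e : Sym2 β)} ∪ Set.range ψ = h ∧
      (h ∩ Set.range g).Nontrivial ∧
      (∀ b, g b ∈ h → b ∈ (e : Sym2 β)) ∧ ∀ i, ψ i ∉ Set.range g := by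
    rintro ⟨e, he⟩
    induction e using Sym2.ind with
    | _ a b =>
      obtain ⟨hne, h, hh, ha, hb⟩ := hadj a b he
      have hpair : g '' {v : β | v ∈ s(a, b)} = {g a, g b} := by
        rw [show {v : β | v ∈ s(a, b)} = {a, b} by ext; simp, Set.image_pair]
      have honly : ∀ c, g c ∈ h → c = a ∨ c = b := fun c hc =>
        (hS.1 h hh _ ⟨a, rfl⟩ _ ⟨b, rfl⟩ _ ⟨c, rfl⟩ ha hb hc hne).imp (hg ·) (hg ·)
      have hsub : ({g a, g b} : Set α) ⊆ h := Set.pair_subset ha hb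
      have hfin : h.Finite := Set.finite_of_ncard_ne_zero (by rw [hu h hh]; omega)
      obtain ⟨D, hD⟩ : ∃ D : Finset α, (D : Set α) = h \ {g a, g b} :=
        ⟨hfin.toFinset \ {g a, g b}, by simp⟩
      have hcard : D.card = r - 2 := by
        rw [← Set.ncard_coe_finset, hD, Set.ncard_sdiff hsub (by simp), hu h hh,
          Set.ncard_pair hne]
      let ψ := D.equivFinOfCardEq hcard
      have hrange : Set.range (fun i => (ψ.symm i : α)) = h \ {g a, g b} := by
        rw [← hD, Set.range_comp' (g := Subtype.val) (f := ψ.symm), ψ.symm.surjective.range_eq]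
        simp
      refine ⟨h, fun i => ψ.symm i, hh, Subtype.val_injective.comp ψ.symm.injective, ?_,
        ⟨g a, ⟨ha, a, rfl⟩, g b, ⟨hb, b, rfl⟩, hne⟩, fun c hc => by simpa using honly c hc, ?_⟩
      · rw [hpair, hrange, Set.union_sdiff_cancel hsub]
      · rintro i ⟨c, hc⟩
        have hi : g c ∈ h \ {g a, g b} := by
          rw [hc, ← hrange]
          exact Set.mem_range_self i
        rcases honly c hi.1 with rfl | rfl
        · exact hi.2 (Or.inl rfl)
        · exact hi.2 (Or.inr rfl)
  choose h ψ hh hψ heq hnt honly hψg using hedge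
  have hψh : ∀ e i, ψ e i ∈ h e := fun e i => heq e ▸ Or.inr ⟨i, rfl⟩
  have hgh : ∀ e : F.edgeSet, ∀ b ∈ (e : Sym2 β), g b ∈ h e := fun e b hb =>
    heq e ▸ Or.inl ⟨b, hb, rfl⟩
  have hhinj : Function.Injective h := by
    intro e e' hee
    refine Subtype.ext (Sym2.ext fun b => ⟨fun hb => ?_, fun hb => ?_⟩)
    · exact honly e' b (hee ▸ hgh e b hb)
    · exact honly e b (hee ▸ hgh e' b hb)
  refine ⟨Sum.elim g fun p => ψ p.1 p.2, ?_, ?_, ?_⟩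
  · refine Function.Injective.injOn (hg.sumElim ?_ fun b p hbp => hψg p.1 p.2 ⟨b, hbp⟩)
    rintro ⟨e, i⟩ ⟨e', j⟩ (hij : ψ e i = ψ e' j)
    -- Distinct edges of `F` use distinct hyperedges, which by pair-sparsity meet only inside
    -- `Set.range g`, a set that `ψ` avoids.
    obtain rfl : e = e' := by
      by_contra hee
      exact hψg e i (hS.2 _ (hh e) _ (hh e') (hhinj.ne hee) (hnt e) (hnt e')
        ⟨hψh e i, hij ▸ hψh e' j⟩)
    rw [hψ e hij]
  · rintro (b | ⟨e, i⟩) _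
    · exact hgV b
    · exact H.subset_vertexSet_of_mem_edgeSet' (hh e) (hψh e i)
  · rintro _ ⟨e, rfl⟩
    convert hh e using 1
    rw [← heq e, Set.image_union, Set.image_image, Set.image_image]
    congr 1
    ext z
    simp only [Sum.elim_inr, Set.mem_image, Set.mem_range, Set.mem_ofPred_eq]
    constructor
    · rintro ⟨⟨e', i⟩, rfl, rfl⟩
      exact ⟨i, rfl⟩
    · rintro ⟨i, rfl⟩
      exact ⟨(e, i), rfl, rfl⟩

end Hypergraph

/-! ### The main theorem -/

theorem theorem2p14 (k ℓ r : ℕ) (hk : 2 ≤ k) (hℓ : 1 ≤ ℓ) (hr : 2 ≤ r)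
    (ε : ℝ) (hε : 0 < ε) (hεk : ε < 1 / ((k : ℝ) - 1)) :
    ∃ n₀ : ℕ, ∀ n : ℕ, n₀ ≤ n →
      ∀ (α : Type*) (H : Hypergraph α), H.vertexSet.Finite → H.vertexSet.ncard = n →
        H.IsUniform r → H.IsLinear →
        2 * (n : ℝ) / ((r : ℝ) - 1) * (1 - 1 / (k : ℝ) + ε) ≤ H.qIndex r →
        H.ContainsCopy
          (Hypergraph.expansion (SimpleGraph.completeEquipartiteGraph (k + 1) ℓ) r) := by
  classical
  have hk2 : (2 : ℝ) ≤ k := by exact_mod_cast hk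
  have hr2 : (2 : ℝ) ≤ r := by exact_mod_cast hr
  have hε1 : ε ≤ 1 := hεk.le.trans (by rw [div_le_one (by linarith)]; linarith)
  -- `m` counts the vertices of `K_{k+1}[ℓ]`; `L` is one more than the double-closure bound for `m`
  -- vertices.
  let m := (k + 1) * ℓ
  let L := (m + m ^ 2 * r) + (m + m ^ 2 * r) ^ 2 * r + 1
  obtain ⟨n₀, hn₀⟩ := SimpleGraph.exists_completeEquipartite_of_signlessFormOn k L hk hε hε1
  refine ⟨max n₀ 1, fun n hn α H hfin hcard hu hl hq => ?_⟩
  have hT : hfin.toFinset.card = n := by rw [← Set.ncard_eq_toFinset_card _ hfin, hcard]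
  have hne : H.vertexSet.Nonempty := by
    rw [← Set.ncard_pos hfin, hcard]
    exact (le_max_right _ _).trans hn
  obtain ⟨x, hx, hxq⟩ := (H.isGreatest_qIndex hfin hne (by omega : 1 ≤ r)).1
  have hform := H.signlessForm_le_shadow hfin hr hu hl x
  rw [hxq] at hform
  obtain ⟨f, hf, hfT, hfadj⟩ := hn₀ H.shadow hfin.toFinset _
    (by rw [hT]; exact (le_max_left _ _).trans hn)
    (by
      rw [← hx, finsum_mem_eq_finite_toFinset_sum _ hfin]
      exact Finset.sum_congr rfl fun v _ => Real.sq_sqrt (by positivity))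
    (by
      refine le_trans ?_ hform
      refine le_trans (le_of_eq ?_) (mul_le_mul_of_nonneg_left hq (by linarith))
      have : (r : ℝ) - 1 ≠ 0 := by linarith
      rw [hT]
      field_simp)
  have : Nonempty α := hne.to_subtype.map Subtype.val
  -- All `ℓ` vertices of a part draw from the same `L` candidates, the matching part of
  -- `K_{k+1}[L]`, so adjacency in the shadow is inherited; injectivity of `g` keeps them apart.
  obtain ⟨g, hgA, hginj, hgS⟩ := Hypergraph.exists_pairSparse_representatives hr hu hl
    (Finset.univ : Finset (Fin (k + 1) × Fin ℓ))
    (fun p => Finset.univ.image fun t : Fin L => f (p.1, t)) (m := m) (M := L) (by simp [m])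
    (Nat.lt_succ_self _) (fun p _ => by
      rw [Finset.card_image_of_injective _ fun s t h => (Prod.ext_iff.1 (hf h)).2]
      simp)
  rw [Finset.coe_univ, Set.injOn_univ] at hginj
  rw [Finset.coe_univ, Set.image_univ] at hgS
  have hgf : ∀ p, ∃ t, f (p.1, t) = g p := fun p => by simpa using hgA p (Finset.mem_univ p)
  refine Hypergraph.containsCopy_expansion_of_pairSparse hr hu hginj (fun p => ?_)
    (fun p q hpq => ?_) hgS
  · obtain ⟨t, ht⟩ := hgf p
    exact ht ▸ hfin.mem_toFinset.1 (hfT _)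
  · obtain ⟨s, hs⟩ := hgf p
    obtain ⟨t, ht⟩ := hgf q
    rw [← hs, ← ht]
    exact hfadj _ _ hpq
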